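/- **Estimating the mean of a standard Gaussian under mean-shift contamination.** For $\alpha\in(0,1/4)$, $\mu\in\mathbb R^d$ and a probability distribution $Q$ on $\mathbb R^d$, an $\alpha$-mean-shift contaminated sample from $\mathcal N(\mu,I_d)$ is generated as follows: draw $y\sim\mathcal N(0,I_d)$; with probability $1-\alpha$ output $\mu+y$, and with probability $\alpha$ output $z+y$, where $z\sim Q$ is drawn independently of $y$. There is an absolute constant $C>0$ such that the following holds. Let $\alpha\in(0,1/4)$, $\epsilon\in(0,1)$, let $d\ge 1$ be an integer, and let $n$ be any integer with $$ n\;\ge\; C\,\frac{d}{\max(\alpha,\epsilon)^2}\,\log\!\Big(\frac{2d}{\max(\alpha,\epsilon)}\Big)\,e^{C(\alpha/\epsilon)^2}. $$ Then there is a (measurable, deterministic) estimator $\widehat\mu:(\mathbb R^d)^n\to\mathbb R^d$, depending only on $\alpha,\epsilon,d,n$, such that for every $\mu\in\mathbb R^d$ and every probability distribution $Q$ on $\mathbb R^d$, if $x_1,\dots,x_n$ are i.i.d. $\alpha$-mean-shift contaminated samples from $\mathcal N(\mu,I_d)$ with shift distribution $Q$, then $$ \Pr\big[\,\|\widehat\mu(x_1,\dots,x_n)-\mu\|_2\le\epsilon\,\big]\;\ge\;2/3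 . $$ In particular, for every fixed $\alpha$, $\widetilde O_\alpha\big(d\,e^{O((\alpha/\epsilon)^2)}\big)$ samples suffice. -/

import Mathlib

open MeasureTheory ProbabilityTheory

/-- The law of one `α`-mean-shift contaminated sample from `D_μ`: with probability `1 - α` the
sample is `μ + y`, and with probability `α` it is `z + y`, where `y ∼ D` and the adversarial
shift `z ∼ Q` is independent of `y`. -/
noncomputable def meanShiftContaminated {E : Type*} [AddCommGroup E] [MeasurableSpace E]
    (D Q : Measure E) (α : ℝ) (μ : E) : Measure E :=
  ENNReal.ofReal (1 - α) • (Measure.dirac μ ∗ D) + ENNReal.ofReal α • (Q ∗ D)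

/-- The joint law of `n` independent samples from `P`. -/
noncomputable def iidSamples {E : Type*} [MeasurableSpace E] (P : Measure E) (n : ℕ) :
    Measure (Fin n → E) :=
  Measure.pi fun _ => P

/-! Convolution with the Gaussian multiplies characteristic functions by `exp (-‖t‖^2 / 2)`. Undoing
this factor leaves `(1 - α) e^{i⟨μ,t⟩} + α φ_Q(t)`, which is within `α` of `(1 - α) e^{i⟨μ,t⟩}`
whatever `Q` is. A candidate `ν` is therefore tested by comparing its phases with the deconvolved
empirical characteristic function, with tolerance `u = α + m / 8`, where `m = max α ε`.

If `‖ν - μ‖ > ε`, some `t` parallel to `ν - μ` with `‖t‖ ≤ 6 * u / ε` gives a phase gap of exactly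
`6 * u`, too large for both points to pass (`exists_frequency_separating`,
`dist_le_of_acceptsMean`). Since `6 * u / ε = O(1 + α/ε)`, deconvolution amplifies the sampling
error by at most `e^{O(1 + (α/ε)^2)}`, the source of the exponential factor.

Requiring most of the sample to lie near `ν` confines the candidates to a ball of radius `O(√d)`
about `μ`, so a finite net of frequencies, independent of `μ`, suffices. Hoeffding and a union bound
over this net, of log-cardinality `O(d log((1 + α/ε) d / m))`, show that `μ` passes. Any measurable
choice of a passing point is then within `ε` of `μ`. -/

/-! ### Concentration and measurable selection. -/

/-- Two-sided Hoeffding inequality for the empirical mean of a function bounded by one. -/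
theorem iidSamples_empiricalMean_deviation {E : Type*} [MeasurableSpace E] (P : Measure E)
    [IsProbabilityMeasure P] {f : E → ℝ} (hf : Measurable f) (hb : ∀ x, |f x| ≤ 1) {n : ℕ}
    (hn : 0 < n) {s : ℝ} (hs : 0 ≤ s) :
    (iidSamples P n).real {x | s ≤ |(∑ j, f (x j)) / n - ∫ y, f y ∂P|} ≤
      2 * Real.exp (-(n * s ^ 2 / 2)) := by
  have one_sided : ∀ g : E → ℝ, Measurable g → (∀ x, |g x| ≤ 1) →
      (iidSamples P n).real {x | n * s ≤ ∑ j, (g (x j) - ∫ y, g y ∂P)} ≤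
        Real.exp (-(n * s ^ 2 / 2)) := by
    intro g hg hgb
    have hsub : HasSubgaussianMGF (fun y => g y - ∫ y, g y ∂P) 1 P := by
      have h := hasSubgaussianMGF_of_mem_Icc (μ := P) (X := g) (a := -1) (b := 1)
        hg.aemeasurable (Filter.Eventually.of_forall fun x => abs_le.1 (hgb x))
      have h1 : (‖(1 : ℝ) - (-1)‖₊ / 2) ^ 2 = 1 := by
        rw [← NNReal.coe_inj]; norm_num
      rwa [h1] at h
    have hind : iIndepFun (fun (j : Fin n) (x : Fin n → E) => g (x j) - ∫ y, g y ∂P)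
        (iidSamples P n) :=
      iIndepFun_pi (μ := fun _ : Fin n => P) (X := fun _ y => g y - ∫ y, g y ∂P)
        fun _ => (hg.sub_const _).aemeasurable
    have hsubj : ∀ j ∈ (Finset.univ : Finset (Fin n)),
        HasSubgaussianMGF (fun x : Fin n → E => g (x j) - ∫ y, g y ∂P) 1 (iidSamples P n) := by
      intro j _
      have hmp : Measure.map (fun x : Fin n → E => x j) (iidSamples P n) = P :=
        (measurePreserving_eval (fun _ : Fin n => P) j).map_eq
      refine HasSubgaussianMGF.of_map (Y := fun x : Fin n → E => x j)
        (X := fun y => g y - ∫ y, g y ∂P) (measurable_pi_apply j).aemeasurable ?_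
      rwa [hmp]
    have h := HasSubgaussianMGF.measure_sum_ge_le_of_iIndepFun hind hsubj
      (ε := n * s) (by positivity)
    refine h.trans_eq ?_
    have hn' : (n : ℝ) ≠ 0 := by positivity
    congr 1
    simp
    field_simp
  have hn' : (0 : ℝ) < n := by positivity
  have hsubset : {x : Fin n → E | s ≤ |(∑ j, f (x j)) / n - ∫ y, f y ∂P|} ⊆
      {x | n * s ≤ ∑ j, (f (x j) - ∫ y, f y ∂P)} ∪
        {x | n * s ≤ ∑ j, (-f (x j) - ∫ y, -f y ∂P)} := by
    intro x hx
    have hx' : s ≤ |(∑ j, f (x j)) / n - ∫ y, f y ∂P| := hx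
    have e1 : ∑ j, (f (x j) - ∫ y, f y ∂P) = n * ((∑ j, f (x j)) / n - ∫ y, f y ∂P) := by
      rw [Finset.sum_sub_distrib]; simp; field_simp
    have e2 : ∑ j, (-f (x j) - ∫ y, -f y ∂P) = n * -((∑ j, f (x j)) / n - ∫ y, f y ∂P) := by
      rw [Finset.sum_sub_distrib, integral_neg]
      simp
      field_simp
      ring
    rcases le_abs.1 hx' with h | h
    · left
      change (n : ℝ) * s ≤ _
      rw [e1]
      gcongr
    · right
      change (n : ℝ) * s ≤ _
      rw [e2]
      gcongr
  have : IsProbabilityMeasure (iidSamples P n) := by unfold iidSamples; infer_instance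
  calc _ ≤ _ := measureReal_mono hsubset
    _ ≤ _ := measureReal_union_le _ _
    _ ≤ _ := by
      rw [two_mul]
      exact add_le_add (one_sided f hf hb)
        (one_sided (fun y => -f y) hf.neg fun x => by simpa using hb x)

/-- Measurable selection: a measurable family of acceptance tests, one of which accepts a
neighbourhood of some point, can be turned into a measurable choice of an accepted point. -/
theorem exists_measurable_selection {Ω E : Type*} [MeasurableSpace Ω] [MeasurableSpace E]
    [TopologicalSpace E] [TopologicalSpace.SeparableSpace E] [Nonempty E]
    (accept : Ω → E → Prop) (hm : ∀ ν, MeasurableSet {x | accept x ν}) :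
    ∃ est : Ω → E, Measurable est ∧
      ∀ x μ, (∀ᶠ ν in nhds μ, accept x ν) → accept x (est x) := by
  classical
  -- The second alternative covers samples for which no dense point is accepted, so that `Nat.find`
  -- is total.
  let p : Ω → ℕ → Prop := fun x k => accept x (TopologicalSpace.denseSeq E k) ∨
    ∀ i, ¬ accept x (TopologicalSpace.denseSeq E i)
  have hp : ∀ x, ∃ k, p x k := by
    intro x
    by_cases h : ∃ k, accept x (TopologicalSpace.denseSeq E k)
    · exact h.imp fun k hk => Or.inl hk
    · exact ⟨0, Or.inr (not_exists.1 h)⟩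
  have hnone : MeasurableSet {x | ∀ i, ¬ accept x (TopologicalSpace.denseSeq E i)} := by
    have : {x | ∀ i, ¬ accept x (TopologicalSpace.denseSeq E i)} =
        ⋂ i, {x | accept x (TopologicalSpace.denseSeq E i)}ᶜ := by ext; simp
    rw [this]
    exact MeasurableSet.iInter fun i => (hm _).compl
  have hpm : ∀ k, MeasurableSet {x | p x k} := fun k => (hm _).union hnone
  refine ⟨fun x => TopologicalSpace.denseSeq E (Nat.find (hp x)),
    (measurable_from_nat).comp (measurable_find hp hpm), ?_⟩
  intro x μ hμ
  obtain ⟨U, hU, hUo, hμU⟩ := mem_nhds_iff.1 hμ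
  obtain ⟨k, hk⟩ := (TopologicalSpace.denseRange_denseSeq E).exists_mem_open hUo ⟨μ, hμU⟩
  rcases Nat.find_spec (hp x) with h | h
  · exact h
  · exact absurd (hU hk) (h k)

/-! ### The contaminated law: characteristic function and mass near the mean. -/

theorem isProbabilityMeasure_meanShiftContaminated {E : Type*} [AddCommGroup E]
    [MeasurableSpace E] [MeasurableAdd₂ E] (D Q : Measure E) [IsProbabilityMeasure D]
    [IsProbabilityMeasure Q] {α : ℝ} (h0 : 0 ≤ α) (h1 : α ≤ 1) (μ : E) :
    IsProbabilityMeasure (meanShiftContaminated D Q α μ) := by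
  constructor
  simp only [meanShiftContaminated, Measure.coe_add, Measure.coe_smul, Pi.add_apply, Pi.smul_apply,
    measure_univ, smul_eq_mul, mul_one]
  rw [← ENNReal.ofReal_add (by linarith) h0]
  simp

/-- The characteristic function of a mean-shift contaminated Gaussian, up to the Gaussian factor,
lies in a disc of radius `α`. -/
theorem charFun_meanShiftContaminated_stdGaussian {E : Type*} [NormedAddCommGroup E]
    [InnerProductSpace ℝ E] [FiniteDimensional ℝ E] [MeasurableSpace E] [BorelSpace E]
    (Q : Measure E) [IsProbabilityMeasure Q] {α : ℝ} (h0 : 0 ≤ α) (h1 : α ≤ 1) (μ t : E) :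
    ‖Complex.exp (‖t‖ ^ 2 / 2) * charFun (meanShiftContaminated (stdGaussian E) Q α μ) t -
      (1 - α) * Complex.exp (inner ℝ μ t * Complex.I)‖ ≤ α := by
  have hcf : charFun (meanShiftContaminated (stdGaussian E) Q α μ) t =
      (1 - α) * charFun (Measure.dirac μ ∗ stdGaussian E) t +
        α * charFun (Q ∗ stdGaussian E) t := by
    have hint : ∀ (ρ : Measure E) [IsProbabilityMeasure ρ],
        Integrable (fun x => Complex.exp (inner ℝ x t * Complex.I)) ρ := fun ρ _ =>
      Integrable.of_bound (by fun_prop) 1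
        (Filter.Eventually.of_forall fun x => by rw [Complex.norm_exp_ofReal_mul_I])
    simp only [charFun_apply, meanShiftContaminated]
    rw [integral_add_measure ((hint _).smul_measure ENNReal.ofReal_ne_top)
      ((hint _).smul_measure ENNReal.ofReal_ne_top), integral_smul_measure,
      integral_smul_measure, ENNReal.toReal_ofReal h0, ENNReal.toReal_ofReal (by linarith)]
    simp [Complex.real_smul]
  rw [hcf, charFun_conv, charFun_conv, charFun_dirac, charFun_stdGaussian]
  have he : Complex.exp (‖t‖ ^ 2 / 2) * Complex.exp (-‖t‖ ^ 2 / 2) = 1 := by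
    rw [← Complex.exp_add]; simp [neg_div]
  have : Complex.exp (‖t‖ ^ 2 / 2) * ((1 - α) * (Complex.exp (inner ℝ μ t * Complex.I) *
      Complex.exp (-‖t‖ ^ 2 / 2)) + α * (charFun Q t * Complex.exp (-‖t‖ ^ 2 / 2))) -
      (1 - α) * Complex.exp (inner ℝ μ t * Complex.I) = α * charFun Q t := by
    linear_combination ((1 - α) * Complex.exp (inner ℝ μ t * Complex.I) + α * charFun Q t) * he
  rw [this, norm_mul, Complex.norm_real, Real.norm_of_nonneg h0]
  exact mul_le_of_le_one_right h0 (norm_charFun_le_one t)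

/-- The squared norm of a standard Gaussian vector has mean equal to the dimension. -/
theorem integrable_and_integral_norm_sq_stdGaussian (d : ℕ) :
    Integrable (fun y => ‖y‖ ^ 2) (stdGaussian (EuclideanSpace ℝ (Fin d))) ∧
    ∫ y, ‖y‖ ^ 2 ∂(stdGaussian (EuclideanSpace ℝ (Fin d))) = d := by
  have hi : ∀ i : Fin d, Integrable (fun y : EuclideanSpace ℝ (Fin d) => y i ^ 2)
      (stdGaussian (EuclideanSpace ℝ (Fin d))) ∧
      ∫ y, y i ^ 2 ∂(stdGaussian (EuclideanSpace ℝ (Fin d))) = 1 := by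
    intro i
    let L : StrongDual ℝ (EuclideanSpace ℝ (Fin d)) := EuclideanSpace.proj i
    have hL : MemLp L 2 (stdGaussian (EuclideanSpace ℝ (Fin d))) :=
      IsGaussian.memLp_dual _ L 2 (by simp)
    refine ⟨hL.integrable_sq, ?_⟩
    have h := variance_dual_stdGaussian L
    rw [variance_of_integral_eq_zero L.continuous.aemeasurable
      (integral_strongDual_stdGaussian L)] at h
    have hn : ‖L‖ = 1 := by
      have : L = innerSL ℝ (EuclideanSpace.basisFun (Fin d) ℝ i) := by
        ext y; simp [L, EuclideanSpace.inner_single_left]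
      rw [this, innerSL_apply_norm]
      simp
    rw [hn] at h
    simpa [L] using h
  simp only [EuclideanSpace.real_norm_sq_eq]
  refine ⟨integrable_finsetSum _ fun i _ => (hi i).1, ?_⟩
  rw [integral_finsetSum _ fun i _ => (hi i).1]
  simp [(hi _).2]

/-- By Markov's inequality, a standard Gaussian vector has norm at most `4 √d` with high
probability. -/
theorem stdGaussian_closedBall_ge {d : ℕ} (hd : 1 ≤ d) :
    15 / 16 ≤ (stdGaussian (EuclideanSpace ℝ (Fin d))).real
      (Metric.closedBall 0 (4 * Real.sqrt d)) := by
  obtain ⟨hi, he⟩ := integrable_and_integral_norm_sq_stdGaussian d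
  have hd' : (0 : ℝ) < d := by exact_mod_cast hd
  have hM := mul_meas_ge_le_integral_of_nonneg
    (Filter.Eventually.of_forall fun y => sq_nonneg ‖y‖) hi (16 * (d : ℝ))
  rw [he] at hM
  have hsub : (Metric.closedBall (0 : EuclideanSpace ℝ (Fin d)) (4 * Real.sqrt d))ᶜ ⊆
      {y | 16 * (d : ℝ) ≤ ‖y‖ ^ 2} := by
    intro y hy
    simp only [Set.mem_compl_iff, mem_closedBall_zero_iff, not_le] at hy
    change 16 * (d : ℝ) ≤ ‖y‖ ^ 2
    have := Real.sq_sqrt hd'.le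
    nlinarith [Real.sqrt_nonneg (d : ℝ)]
  have hc := measureReal_mono (μ := stdGaussian (EuclideanSpace ℝ (Fin d))) hsub
  rw [probReal_compl_eq_one_sub Metric.isClosed_closedBall.measurableSet] at hc
  have : (stdGaussian (EuclideanSpace ℝ (Fin d))).real {y | 16 * (d : ℝ) ≤ ‖y‖ ^ 2} ≤ 1 / 16 := by
    rw [le_div_iff₀ (by norm_num)]
    nlinarith
  linarith

/-- Only the uncontaminated component is kept; the adversarial one contributes nonnegative mass. -/
theorem meanShiftContaminated_closedBall_ge {E : Type*} [NormedAddCommGroup E]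
    [MeasurableSpace E] [BorelSpace E] [SecondCountableTopology E] (D Q : Measure E)
    [IsProbabilityMeasure D] [IsProbabilityMeasure Q] {α : ℝ} (h1 : α ≤ 1) (μ : E) (r : ℝ) :
    (1 - α) * D.real (Metric.closedBall 0 r) ≤
      (meanShiftContaminated D Q α μ).real (Metric.closedBall μ r) := by
  have hd : (Measure.dirac μ ∗ D) (Metric.closedBall μ r) = D (Metric.closedBall 0 r) := by
    rw [Measure.dirac_conv, Measure.map_apply (by fun_prop) Metric.isClosed_closedBall.measurableSet]
    congr 1
    ext y
    simp
  have hle : ENNReal.ofReal (1 - α) * D (Metric.closedBall 0 r) ≤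
      meanShiftContaminated D Q α μ (Metric.closedBall μ r) := by
    simp only [meanShiftContaminated, Measure.coe_add, Measure.coe_smul, Pi.add_apply,
      Pi.smul_apply, smul_eq_mul, hd]
    exact le_self_add
  have htop : meanShiftContaminated D Q α μ (Metric.closedBall μ r) ≠ ⊤ := by
    simp only [meanShiftContaminated, Measure.coe_add, Measure.coe_smul, Pi.add_apply,
      Pi.smul_apply, smul_eq_mul]
    exact ENNReal.add_ne_top.2 ⟨ENNReal.mul_ne_top ENNReal.ofReal_ne_top (measure_ne_top _ _),
      ENNReal.mul_ne_top ENNReal.ofReal_ne_top (measure_ne_top _ _)⟩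
  have := ENNReal.toReal_mono htop hle
  rwa [ENNReal.toReal_mul, ENNReal.toReal_ofReal (by linarith)] at this

/-! ### Frequency grid and separation of phases. -/

/-- A grid of mesh `h` in a box contains a point within `h √d` of every point of the ball. -/
theorem exists_finset_grid (d k : ℕ) {h T : ℝ} (hh : 0 < h) (hT : T ≤ k * h) :
    ∃ N : Finset (EuclideanSpace ℝ (Fin d)), N.card ≤ (2 * k + 1) ^ d ∧
      ∀ t : EuclideanSpace ℝ (Fin d), ‖t‖ ≤ T → ∃ s ∈ N, ‖s - t‖ ≤ Real.sqrt d * h := by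
  classical
  let F : (Fin d → ℤ) → EuclideanSpace ℝ (Fin d) := fun a => WithLp.toLp 2 fun i => (a i : ℝ) * h
  refine ⟨(Fintype.piFinset fun _ => Finset.Icc (-(k : ℤ)) k).image F, ?_, ?_⟩
  · refine Finset.card_image_le.trans ?_
    rw [Fintype.card_piFinset]
    simp only [Int.card_Icc, Finset.prod_const, Finset.card_univ, Fintype.card_fin]
    apply le_of_eq
    congr 1
    omega
  · intro t ht
    refine ⟨F fun i => ⌊t i / h⌋, Finset.mem_image_of_mem _ ?_, ?_⟩
    · simp only [Fintype.mem_piFinset, Finset.mem_Icc]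
      intro i
      have hi : |t i| ≤ k * h := by
        have := PiLp.norm_apply_le t i
        rw [Real.norm_eq_abs] at this
        linarith
      have h1 := abs_le.1 hi
      constructor
      · rw [Int.le_floor, le_div_iff₀ hh]; push_cast; linarith
      · have : (⌊t i / h⌋ : ℝ) ≤ k := (Int.floor_le _).trans (by rw [div_le_iff₀ hh]; linarith)
        exact_mod_cast this
    · rw [EuclideanSpace.norm_eq]
      rw [show Real.sqrt d * h = Real.sqrt (d * h ^ 2) by
        rw [Real.sqrt_mul (Nat.cast_nonneg d), Real.sqrt_sq hh.le]]
      apply Real.sqrt_le_sqrt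
      calc ∑ i, ‖(F (fun i => ⌊t i / h⌋) - t) i‖ ^ 2 ≤ ∑ _i : Fin d, h ^ 2 := by
            refine Finset.sum_le_sum fun i _ => ?_
            have e : (F (fun i => ⌊t i / h⌋) - t) i = (⌊t i / h⌋ : ℝ) * h - t i := by simp [F]
            rw [e, Real.norm_eq_abs, sq_abs]
            have h1 := Int.floor_le (t i / h)
            have h2 := (Int.lt_floor_add_one (t i / h)).le
            rw [le_div_iff₀ hh] at h1
            rw [div_le_iff₀ hh] at h2
            nlinarith
        _ = d * h ^ 2 := by simp

/-- The chord over an angle `θ` has length `2 sin(θ/2)`, and Jordan's inequality bounds the sine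
below by a linear function. -/
theorem norm_exp_sub_exp_ge {x y : ℝ} (h0 : 0 ≤ x - y) (hpi : x - y ≤ Real.pi) :
    2 / Real.pi * (x - y) ≤ ‖Complex.exp (x * Complex.I) - Complex.exp (y * Complex.I)‖ := by
  have e : Complex.exp (x * Complex.I) - Complex.exp (y * Complex.I) =
      Complex.exp (y * Complex.I) * (Complex.exp (Complex.I * ((x - y : ℝ) : ℂ)) - 1) := by
    rw [mul_sub, ← Complex.exp_add, mul_one]
    congr 2
    push_cast
    ring
  rw [e, norm_mul, Complex.norm_exp_ofReal_mul_I, one_mul, Complex.norm_exp_I_mul_ofReal_sub_one]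
  have := Real.mul_le_sin (x := (x - y) / 2) (by linarith) (by linarith)
  rw [Real.norm_eq_abs]
  refine le_trans ?_ (le_abs_self _)
  linarith

/-- Two points at distance more than `ε` are told apart by the phases at some frequency
of a sufficiently fine net. -/
theorem exists_frequency_separating {E : Type*} [NormedAddCommGroup E] [InnerProductSpace ℝ E]
    {N : Finset E} {T R u ε : ℝ} (hε : 0 < ε) (hu : 0 < u) (hu' : u ≤ 3 / 8) (hR : 0 < R)
    (hT : 6 * u / ε ≤ T)
    (hN : ∀ t : E, ‖t‖ ≤ T → ∃ s ∈ N, ‖s - t‖ ≤ u / R) {ν μ : E} (h1 : ε < ‖ν - μ‖)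
    (h2 : ‖ν - μ‖ ≤ R) :
    ∃ t ∈ N, 8 / 3 * u < ‖Complex.exp (inner ℝ ν t * Complex.I) -
      Complex.exp (inner ℝ μ t * Complex.I)‖ := by
  set r := ‖ν - μ‖ with hr
  have hr0 : 0 < r := hε.trans h1
  -- At this frequency the phase gap is exactly `6 * u`. Rounding to the net moves it by at most `R
  -- * (u / R) = u`, so it lies in `[5 * u, 7 * u]`, below `π` since `u ≤ 3 / 8`; finally `10 / π >
  -- 8 / 3`.
  obtain ⟨t, htN, ht⟩ := hN ((6 * u / r ^ 2) • (ν - μ)) (by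
    rw [norm_smul, Real.norm_of_nonneg (by positivity), ← hr]
    calc 6 * u / r ^ 2 * r = 6 * u / r := by field_simp
      _ ≤ 6 * u / ε := by gcongr
      _ ≤ T := hT)
  refine ⟨t, htN, ?_⟩
  have hin : |inner ℝ ν t - inner ℝ μ t - 6 * u| ≤ u := by
    have e : inner ℝ ν t - inner ℝ μ t - 6 * u =
        inner ℝ (ν - μ) (t - (6 * u / r ^ 2) • (ν - μ)) := by
      rw [inner_sub_right, inner_smul_right, real_inner_self_eq_norm_sq, ← hr, inner_sub_left]
      field_simp
    rw [e]
    calc _ ≤ ‖ν - μ‖ * ‖t - (6 * u / r ^ 2) • (ν - μ)‖ := abs_real_inner_le_norm _ _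
      _ ≤ R * (u / R) := by gcongr
      _ = u := by field_simp
  have hab := abs_le.1 hin
  have hpi := Real.pi_gt_three
  have hpi' := Real.pi_lt_d2
  have := norm_exp_sub_exp_ge (x := inner ℝ ν t) (y := inner ℝ μ t) (by linarith) (by linarith)
  refine lt_of_lt_of_le ?_ this
  have h3 : 2 / Real.pi * (5 * u) ≤ 2 / Real.pi * (inner ℝ ν t - inner ℝ μ t) := by
    gcongr; linarith
  refine lt_of_lt_of_le ?_ h3
  rw [div_mul_eq_mul_div 2, lt_div_iff₀ Real.pi_pos]
  nlinarith

/-- Writes the real part as the mean of a function bounded by one, to which Hoeffding applies. -/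
theorem charFun_re {E : Type*} [SeminormedAddCommGroup E] [InnerProductSpace ℝ E]
    [MeasurableSpace E] [OpensMeasurableSpace E] (P : Measure E) [IsFiniteMeasure P] (t : E) :
    (charFun P t).re = ∫ y, Real.cos (inner ℝ y t) ∂P := by
  have hint : Integrable (fun x => Complex.exp (inner ℝ x t * Complex.I)) P :=
    Integrable.of_bound (Measurable.aestronglyMeasurable (by fun_prop)) 1
      (Filter.Eventually.of_forall fun x => by rw [Complex.norm_exp_ofReal_mul_I])
  rw [charFun_apply]
  have := integral_re hint
  simp only [RCLike.re_to_complex, Complex.exp_ofReal_mul_I_re] at this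
  exact this.symm

theorem charFun_im {E : Type*} [SeminormedAddCommGroup E] [InnerProductSpace ℝ E]
    [MeasurableSpace E] [OpensMeasurableSpace E] (P : Measure E) [IsFiniteMeasure P] (t : E) :
    (charFun P t).im = ∫ y, Real.sin (inner ℝ y t) ∂P := by
  have hint : Integrable (fun x => Complex.exp (inner ℝ x t * Complex.I)) P :=
    Integrable.of_bound (Measurable.aestronglyMeasurable (by fun_prop)) 1
      (Filter.Eventually.of_forall fun x => by rw [Complex.norm_exp_ofReal_mul_I])
  rw [charFun_apply]
  have := integral_im hint
  simp only [RCLike.im_to_complex, Complex.exp_ofReal_mul_I_im] at this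
  exact this.symm

/-! ### Sample-size arithmetic. -/

/-- The sample size suffices for a union bound over a grid of frequencies. -/
theorem sample_size_bound {α ε m : ℝ} {d n : ℕ} (hα : 0 < α) (hε : 0 < ε)
    (hm0 : 0 < m) (hm1 : m < 1) (hd : 1 ≤ d)
    (hn : 61440 * Real.exp 128 * ((d : ℝ) / m ^ 2) * Real.log (2 * (d : ℝ) / m)
            * Real.exp (61440 * Real.exp 128 * (α / ε) ^ 2) ≤ (n : ℝ))
    {k : ℕ} (hk : (k : ℝ) ≤ 640 * (1 + α / ε) * d / m + 1) :
    18 * ((2 * k + 1 : ℕ) : ℝ) ^ d *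
      Real.exp (-(n * (m / 32 * Real.exp (-((8 * (1 + α / ε)) ^ 2 / 2))) ^ 2 / 2)) ≤ 1 := by
  set a := α / ε with ha
  have ha0 : 0 < a := div_pos hα hε
  have hd' : (1 : ℝ) ≤ d := by exact_mod_cast hd
  set L := Real.log (2 * (d : ℝ) / m) with hL
  have hdm : 1 ≤ d / m := by rw [le_div_iff₀ hm0]; linarith
  have hL2 : Real.log 2 ≤ L := Real.log_le_log (by norm_num) (by rw [mul_div_assoc]; linarith)
  have hlog2 := Real.log_two_gt_d9
  have hL0 : 0 < L := by linarith
  have hK : 18 * ((2 * k + 1 : ℕ) : ℝ) ≤ 2 ^ 14 * (1 + a) * (2 * d / m) := by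
    push_cast
    have e : 640 * (1 + a) * d / m = 640 * (1 + a) * (d / m) := by ring
    have e' : (2 : ℝ) ^ 14 * (1 + a) * (2 * d / m) = 2 ^ 15 * ((1 + a) * (d / m)) := by ring
    rw [e] at hk
    rw [e']
    have : 1 ≤ (1 + a) * (d / m) := by nlinarith
    nlinarith
  have hlogK : Real.log (18 * ((2 * k + 1 : ℕ) : ℝ)) ≤ 15 * (1 + a) * L := by
    have hpos : 0 < 18 * ((2 * k + 1 : ℕ) : ℝ) := by positivity
    refine (Real.log_le_log hpos hK).trans ?_
    rw [Real.log_mul (by positivity) (by positivity), Real.log_mul (by positivity) (by positivity),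
      Real.log_pow, ← hL]
    have : Real.log (1 + a) ≤ a := by
      have := Real.log_le_sub_one_of_pos (x := 1 + a) (by positivity)
      linarith
    push_cast
    nlinarith [mul_pos ha0 hL0]
  have hexp : 1 + a ≤ 2 * Real.exp (a ^ 2) := by
    have := Real.add_one_le_exp (a ^ 2)
    nlinarith [sq_nonneg (a - 1)]
  have hE : Real.exp (129 * a ^ 2) ≤ Real.exp (61440 * Real.exp 128 * a ^ 2) := by
    apply Real.exp_le_exp.2
    have : (1 : ℝ) ≤ Real.exp 128 := Real.one_le_exp (by norm_num)
    gcongr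
    linarith
  -- Uses `(1 + a)^2 ≤ 2 + 2 * a^2`.
  have hS : Real.exp (-128 - 128 * a ^ 2) ≤
      (Real.exp (-((8 * (1 + a)) ^ 2 / 2))) ^ 2 := by
    rw [← Real.exp_nat_mul]
    apply Real.exp_le_exp.2
    push_cast
    nlinarith [sq_nonneg (a - 1)]
  -- Here `61440 = 15 * 2 * 1024 * 2`; the exponent `129 * a^2` pays for `128 * a^2` from
  -- deconvolution and `a^2` from `1 + a ≤ 2 * exp (a^2)`.
  have hmain : d * (15 * (1 + a) * L) ≤
      n * (m / 32 * Real.exp (-((8 * (1 + a)) ^ 2 / 2))) ^ 2 / 2 := by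
    calc d * (15 * (1 + a) * L) ≤ d * (15 * (2 * Real.exp (a ^ 2)) * L) := by gcongr
      _ = (61440 * Real.exp 128 * ((d : ℝ) / m ^ 2) * L * Real.exp (129 * a ^ 2)) *
          (m ^ 2 / 1024 * Real.exp (-128 - 128 * a ^ 2)) / 2 := by
        have : Real.exp 128 * Real.exp (129 * a ^ 2) * Real.exp (-128 - 128 * a ^ 2) =
            Real.exp (a ^ 2) := by
          rw [← Real.exp_add, ← Real.exp_add]; congr 1; ring
        rw [← this]
        field_simp
        ring
      _ ≤ n * (m ^ 2 / 1024 * (Real.exp (-((8 * (1 + a)) ^ 2 / 2))) ^ 2) / 2 := by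
        have h1 : 61440 * Real.exp 128 * ((d : ℝ) / m ^ 2) * L * Real.exp (129 * a ^ 2) ≤ n :=
          le_trans (by gcongr) hn
        gcongr
      _ = _ := by ring
  have hKd : 18 * ((2 * k + 1 : ℕ) : ℝ) ^ d ≤ Real.exp (d * (15 * (1 + a) * L)) := by
    calc 18 * ((2 * k + 1 : ℕ) : ℝ) ^ d ≤ 18 ^ d * ((2 * k + 1 : ℕ) : ℝ) ^ d := by
          gcongr
          exact le_self_pow₀ (by norm_num) (by omega)
      _ = (18 * ((2 * k + 1 : ℕ) : ℝ)) ^ d := (mul_pow _ _ _).symm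
      _ = Real.exp (d * Real.log (18 * ((2 * k + 1 : ℕ) : ℝ))) := by
          rw [Real.exp_nat_mul, Real.exp_log (by positivity)]
      _ ≤ _ := by
          apply Real.exp_le_exp.2
          gcongr
  calc _ ≤ Real.exp (d * (15 * (1 + a) * L)) *
        Real.exp (-(d * (15 * (1 + a) * L))) := by
        gcongr
    _ = 1 := by rw [← Real.exp_add]; simp

/-! ### Empirical quantities and the acceptance test. -/

/-- The empirical characteristic function of a sample. -/
noncomputable def empiricalCharFun {E : Type*} [NormedAddCommGroup E] [InnerProductSpace ℝ E]
    {n : ℕ} (x : Fin n → E) (t : E) : ℂ :=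
  (∑ j, Complex.exp (inner ℝ (x j) t * Complex.I)) / n

/-- The fraction of sample points in a set. -/
noncomputable def empiricalMass {E : Type*} {n : ℕ} (x : Fin n → E) (A : Set E) : ℝ :=
  (∑ j, A.indicator (fun _ => (1 : ℝ)) (x j)) / n

theorem empiricalMass_mono {E : Type*} {n : ℕ} (x : Fin n → E) {A B : Set E} (h : A ⊆ B) :
    empiricalMass x A ≤ empiricalMass x B := by
  unfold empiricalMass
  gcongr

/-- Two sets, each holding more than half of the sample, meet. -/
theorem inter_nonempty_of_empiricalMass {E : Type*} {n : ℕ} {x : Fin n → E} {A B : Set E}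
    (hA : 1 / 2 < empiricalMass x A) (hB : 1 / 2 < empiricalMass x B) : (A ∩ B).Nonempty := by
  by_contra h
  have hn : (0 : ℝ) < n := by
    rcases Nat.eq_zero_or_pos n with rfl | hn
    · simp [empiricalMass] at hA; linarith
    · exact_mod_cast hn
  have hle : empiricalMass x A + empiricalMass x B ≤ 1 := by
    unfold empiricalMass
    rw [← add_div, div_le_one hn, ← Finset.sum_add_distrib]
    calc _ ≤ ∑ _j : Fin n, (1 : ℝ) := by
          refine Finset.sum_le_sum fun j _ => ?_
          by_cases hjA : x j ∈ A
          · have hjB : x j ∉ B := fun hjB => h ⟨x j, hjA, hjB⟩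
            simp [hjA, hjB]
          · by_cases hjB : x j ∈ B <;> simp [hjA, hjB]
      _ = n := by simp
  linarith

theorem measurable_empiricalMass {E : Type*} [MeasurableSpace E] {n : ℕ} {A : Set E} (hA : MeasurableSet A) :
    Measurable fun x : Fin n → E => empiricalMass x A := by
  unfold empiricalMass
  have : Measurable (A.indicator fun _ => (1 : ℝ)) := measurable_const.indicator hA
  fun_prop

section Tests

variable {E : Type*} [NormedAddCommGroup E] [InnerProductSpace ℝ E]

/-- A candidate mean is accepted if most of the sample is within `ρ` of it and its phases agree
with the deconvolved empirical characteristic function, up to `u`, at the frequencies in `N`. -/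
def AcceptsMean (N : Finset E) (α u ρ : ℝ) {n : ℕ} (x : Fin n → E) (ν : E) : Prop :=
  1 / 2 < empiricalMass x (Metric.closedBall ν ρ) ∧
    ∀ t ∈ N, ‖Complex.exp (‖t‖ ^ 2 / 2) * empiricalCharFun x t -
      (1 - α) * Complex.exp (inner ℝ ν t * Complex.I)‖ < u

theorem measurableSet_acceptsMean [MeasurableSpace E] [BorelSpace E] [SecondCountableTopology E]
    (N : Finset E) (α u ρ : ℝ) (n : ℕ) (ν : E) :
    MeasurableSet {x : Fin n → E | AcceptsMean N α u ρ x ν} := by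
  have h1 : MeasurableSet {x : Fin n → E | 1 / 2 < empiricalMass x (Metric.closedBall ν ρ)} :=
    measurableSet_lt measurable_const
      (measurable_empiricalMass Metric.isClosed_closedBall.measurableSet)
  have h2 : MeasurableSet (⋂ t ∈ N, {x : Fin n → E |
      ‖Complex.exp (‖t‖ ^ 2 / 2) * empiricalCharFun x t -
      (1 - α) * Complex.exp (inner ℝ ν t * Complex.I)‖ < u}) := by
    refine N.measurableSet_biInter fun t _ => measurableSet_lt ?_ measurable_const
    unfold empiricalCharFun
    fun_prop
  convert h1.inter h2 using 1
  ext x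
  simp [AcceptsMean]

/-- The phase conditions are strict and continuous in `ν`, and enlarging the radius by one absorbs a
small move of the centre. This openness lets a dense sequence hit an accepted point. -/
theorem eventually_acceptsMean {N : Finset E} {α u ρ : ℝ} {n : ℕ} {x : Fin n → E} {μ : E}
    (h : AcceptsMean N α u ρ x μ) : ∀ᶠ ν in nhds μ, AcceptsMean N α u (ρ + 1) x ν := by
  have h1 : ∀ᶠ ν in nhds μ, dist μ ν ≤ 1 := by
    filter_upwards [Metric.closedBall_mem_nhds μ one_pos] with ν hν
    rwa [dist_comm]
  have h2 : ∀ᶠ ν in nhds μ, ∀ t ∈ N, ‖Complex.exp (‖t‖ ^ 2 / 2) * empiricalCharFun x t -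
      (1 - α) * Complex.exp (inner ℝ ν t * Complex.I)‖ < u := by
    refine (Filter.eventually_all_finset N).2 fun t ht => ?_
    have hc : Continuous fun ν : E => ‖Complex.exp (‖t‖ ^ 2 / 2) * empiricalCharFun x t -
        (1 - α) * Complex.exp (inner ℝ ν t * Complex.I)‖ := by fun_prop
    exact hc.continuousAt.eventually_lt continuousAt_const (h.2 t ht)
  filter_upwards [h1, h2] with ν hν1 hν2
  exact ⟨h.1.trans_le (empiricalMass_mono x (Metric.closedBall_subset_closedBall' (by linarith))),
    hν2⟩

/-- Two accepted means are close. -/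
theorem dist_le_of_acceptsMean {N : Finset E} {α ε u ρ T : ℝ} {n : ℕ}
    {x : Fin n → E} (hα : α < 1 / 4) (hε : 0 < ε) (hu : 0 < u) (hu' : u ≤ 3 / 8) (hρ : 0 < ρ)
    (hT : 6 * u / ε ≤ T)
    (hN : ∀ t : E, ‖t‖ ≤ T → ∃ s ∈ N, ‖s - t‖ ≤ u / (2 * ρ)) {ν μ : E}
    (hν : AcceptsMean N α u ρ x ν) (hμ : AcceptsMean N α u ρ x μ) : ‖ν - μ‖ ≤ ε := by
  by_contra hlt
  obtain ⟨y, hy1, hy2⟩ := inter_nonempty_of_empiricalMass hν.1 hμ.1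
  have hd : ‖ν - μ‖ ≤ 2 * ρ := by
    rw [← dist_eq_norm]
    have := dist_triangle_left ν μ y
    rw [Metric.mem_closedBall] at hy1 hy2
    linarith
  obtain ⟨t, htN, ht⟩ := exists_frequency_separating hε hu hu' (by positivity) hT hN
    (not_le.1 hlt) hd
  have h1 := hν.2 t htN
  have h2 := hμ.2 t htN
  set A := Complex.exp (inner ℝ ν t * Complex.I)
  set B := Complex.exp (inner ℝ μ t * Complex.I)
  set z := Complex.exp (‖t‖ ^ 2 / 2) * empiricalCharFun x t
  -- Both tests give `(1 - α) * ‖A - B‖ < 2 * u`, whereas `α < 1 / 4` and the separation give more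
  -- than `3 / 4 * (8 / 3 * u) = 2 * u`.
  have h3 : (1 - α) * ‖A - B‖ = ‖(z - (1 - α) * B) - (z - (1 - α) * A)‖ := by
    have : (z - (1 - α) * B) - (z - (1 - α) * A) = ((1 - α : ℝ) : ℂ) * (A - B) := by
      push_cast; ring
    rw [this, norm_mul, Complex.norm_real, Real.norm_of_nonneg (by linarith)]
  have h4 := norm_sub_le (z - (1 - α) * B) (z - (1 - α) * A)
  nlinarith [norm_nonneg (A - B)]

end Tests

/-! ### Acceptance of the true mean, and the choice of frequencies. -/

/-- The true mean is accepted as soon as the empirical averages that enter the tests are close to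
their expectations. -/
theorem acceptsMean_of_deviation {d n : ℕ} (hd : 1 ≤ d) {α m s T : ℝ} (hα0 : 0 ≤ α)
    (hα : α < 1 / 4) (hs : s ≤ 1 / 32) (hsT : s = m / 32 * Real.exp (-(T ^ 2 / 2)))
    (hm : 0 < m)
    {N : Finset (EuclideanSpace ℝ (Fin d))} (hN : ∀ t ∈ N, ‖t‖ ≤ T)
    (μ : EuclideanSpace ℝ (Fin d)) (Q P : Measure (EuclideanSpace ℝ (Fin d)))
    [IsProbabilityMeasure Q] (hP : P = meanShiftContaminated (stdGaussian _) Q α μ)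
    {x : Fin n → EuclideanSpace ℝ (Fin d)}
    (hball : |empiricalMass x (Metric.closedBall μ (4 * Real.sqrt d)) -
      P.real (Metric.closedBall μ (4 * Real.sqrt d))| < s)
    (hcos : ∀ t ∈ N, |(empiricalCharFun x t).re - (charFun P t).re| < s)
    (hsin : ∀ t ∈ N, |(empiricalCharFun x t).im - (charFun P t).im| < s) :
    AcceptsMean N α (α + m / 8) (4 * Real.sqrt d) x μ := by
  constructor
  · have h1 := meanShiftContaminated_closedBall_ge (stdGaussian (EuclideanSpace ℝ (Fin d))) Q
      (by linarith : α ≤ 1) μ (4 * Real.sqrt d)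
    rw [← hP] at h1
    -- The ball has mass at least `3 / 4 * 15 / 16 = 45 / 64`, which exceeds `1 / 2 + 1 / 32`.
    have h2 := stdGaussian_closedBall_ge hd
    have h3 := (abs_lt.1 hball).1
    nlinarith
  · intro t ht
    have hcf := charFun_meanShiftContaminated_stdGaussian Q hα0 (by linarith : α ≤ 1) μ t
    rw [← hP] at hcf
    have hdiff : ‖empiricalCharFun x t - charFun P t‖ ≤ 2 * s := by
      have := Complex.norm_le_abs_re_add_abs_im (empiricalCharFun x t - charFun P t)
      rw [Complex.sub_re, Complex.sub_im] at this
      linarith [hcos t ht, hsin t ht]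
    have hexp : ‖Complex.exp (‖t‖ ^ 2 / 2)‖ ≤ Real.exp (T ^ 2 / 2) := by
      rw [Complex.norm_exp]
      apply Real.exp_le_exp.2
      have : ((‖t‖ : ℂ) ^ 2 / 2).re = ‖t‖ ^ 2 / 2 := by
        rw [show ((‖t‖ : ℂ) ^ 2 / 2) = ((‖t‖ ^ 2 / 2 : ℝ) : ℂ) by push_cast; rfl,
          Complex.ofReal_re]
      rw [this]
      have := hN t ht
      gcongr
    -- The factor `exp (-(T^2 / 2))` in `s` is chosen to cancel the amplification; `m / 16 < m / 8`
    -- leaves the test strict.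
    have hprod : ‖Complex.exp (‖t‖ ^ 2 / 2) * (empiricalCharFun x t - charFun P t)‖ ≤ m / 16 := by
      rw [norm_mul]
      calc _ ≤ Real.exp (T ^ 2 / 2) * (2 * s) := by gcongr
        _ = m / 16 * (Real.exp (T ^ 2 / 2) * Real.exp (-(T ^ 2 / 2))) := by rw [hsT]; ring
        _ = m / 16 := by rw [← Real.exp_add]; simp
    have hsplit : Complex.exp (‖t‖ ^ 2 / 2) * empiricalCharFun x t -
        (1 - α) * Complex.exp (inner ℝ μ t * Complex.I) =
        Complex.exp (‖t‖ ^ 2 / 2) * (empiricalCharFun x t - charFun P t) +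
        (Complex.exp (‖t‖ ^ 2 / 2) * charFun P t -
          (1 - α) * Complex.exp (inner ℝ μ t * Complex.I)) := by ring
    rw [hsplit]
    have := norm_add_le (Complex.exp (‖t‖ ^ 2 / 2) * (empiricalCharFun x t - charFun P t))
      (Complex.exp (‖t‖ ^ 2 / 2) * charFun P t -
          (1 - α) * Complex.exp (inner ℝ μ t * Complex.I))
    linarith

/-- Union bound over all the empirical averages that enter the tests. -/
theorem iidSamples_deviation_union {E : Type*} [NormedAddCommGroup E] [InnerProductSpace ℝ E]
    [MeasurableSpace E] [BorelSpace E] [SecondCountableTopology E] (P : Measure E)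
    [IsProbabilityMeasure P] (N : Finset E) {A : Set E} (hA : MeasurableSet A) {n : ℕ}
    (hn : 0 < n) {s : ℝ} (hs : 0 ≤ s) :
    (iidSamples P n).real {x | ¬ (|empiricalMass x A - P.real A| < s ∧
      (∀ t ∈ N, |(empiricalCharFun x t).re - (charFun P t).re| < s) ∧
      ∀ t ∈ N, |(empiricalCharFun x t).im - (charFun P t).im| < s)} ≤
      (2 * N.card + 1) * (2 * Real.exp (-(n * s ^ 2 / 2))) := by
  have : IsProbabilityMeasure (iidSamples P n) := by unfold iidSamples; infer_instance
  set q := 2 * Real.exp (-(n * s ^ 2 / 2))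
  have hmass : (iidSamples P n).real {x | s ≤ |empiricalMass x A - P.real A|} ≤ q := by
    have h := iidSamples_empiricalMean_deviation P (f := A.indicator fun _ => (1 : ℝ))
      (measurable_const.indicator hA)
      (fun x => by by_cases hx : x ∈ A <;> simp [hx]) hn hs
    rwa [integral_indicator_const _ hA, smul_eq_mul, mul_one] at h
  have hre : ∀ t, (iidSamples P n).real
      {x | s ≤ |(empiricalCharFun x t).re - (charFun P t).re|} ≤ q := by
    intro t
    have h := iidSamples_empiricalMean_deviation P (f := fun y => Real.cos (inner ℝ y t))
      (by fun_prop) (fun x => Real.abs_cos_le_one _) hn hs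
    rw [← charFun_re] at h
    convert h using 7 with x
    rw [empiricalCharFun, Complex.div_natCast_re, Complex.re_sum]
    simp only [Complex.exp_ofReal_mul_I_re]
  have him : ∀ t, (iidSamples P n).real
      {x | s ≤ |(empiricalCharFun x t).im - (charFun P t).im|} ≤ q := by
    intro t
    have h := iidSamples_empiricalMean_deviation P (f := fun y => Real.sin (inner ℝ y t))
      (by fun_prop) (fun x => Real.abs_sin_le_one _) hn hs
    rw [← charFun_im] at h
    convert h using 7 with x
    rw [empiricalCharFun, Complex.div_natCast_im, Complex.im_sum]
    simp only [Complex.exp_ofReal_mul_I_im]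
  have hsub : {x | ¬ (|empiricalMass x A - P.real A| < s ∧
      (∀ t ∈ N, |(empiricalCharFun x t).re - (charFun P t).re| < s) ∧
      ∀ t ∈ N, |(empiricalCharFun x t).im - (charFun P t).im| < s)} ⊆
      {x : Fin n → E | s ≤ |empiricalMass x A - P.real A|} ∪
      ((⋃ t ∈ N, {x | s ≤ |(empiricalCharFun x t).re - (charFun P t).re|}) ∪
      ⋃ t ∈ N, {x | s ≤ |(empiricalCharFun x t).im - (charFun P t).im|}) := by
    intro x hx
    by_contra hc
    apply hx
    simpa using hc
  calc _ ≤ _ := measureReal_mono hsub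
    _ ≤ q + (∑ _t ∈ N, q + ∑ _t ∈ N, q) := by
      refine (measureReal_union_le _ _).trans (add_le_add hmass ?_)
      refine (measureReal_union_le _ _).trans (add_le_add ?_ ?_)
      · exact (measureReal_biUnion_finset_le _ _).trans (Finset.sum_le_sum fun t _ => hre t)
      · exact (measureReal_biUnion_finset_le _ _).trans (Finset.sum_le_sum fun t _ => him t)
    _ = (2 * N.card + 1) * q := by simp; ring

/-- The finite set of frequencies at which candidate means are tested. -/
theorem exists_test_frequencies {α ε m : ℝ} {d : ℕ} (hα0 : 0 < α) (hα : α < 1 / 4) (hε : 0 < ε)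
    (hm : m = max α ε) (hm1 : m < 1) (hd : 1 ≤ d) :
    ∃ (k : ℕ) (N : Finset (EuclideanSpace ℝ (Fin d))),
      (k : ℝ) ≤ 640 * (1 + α / ε) * d / m + 1 ∧ N.card ≤ (2 * k + 1) ^ d ∧
      (∀ t ∈ N, ‖t‖ ≤ 8 * (1 + α / ε)) ∧
      ∀ t : EuclideanSpace ℝ (Fin d), ‖t‖ ≤ 6 * (α + m / 8) / ε →
        ∃ s ∈ N, ‖s - t‖ ≤ (α + m / 8) / (2 * (4 * Real.sqrt d + 1)) := by
  classical
  set a := α / ε with ha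
  have ha0 : 0 < a := div_pos hα0 hε
  have hαa : α = a * ε := by rw [ha]; field_simp
  have hm0 : 0 < m := by rw [hm]; exact lt_max_of_lt_left hα0
  have hmle : m ≤ (1 + a) * ε := by
    rw [hm]; exact max_le (by nlinarith) (by nlinarith)
  set u := α + m / 8 with hu
  have hu0 : 0 < u := by positivity
  have hu1 : u ≤ 1 := by linarith
  have hd' : (1 : ℝ) ≤ d := by exact_mod_cast hd
  have hsq1 : 1 ≤ Real.sqrt d := Real.one_le_sqrt.2 hd'
  have hsq : Real.sqrt d * Real.sqrt d = d := Real.mul_self_sqrt (by linarith)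
  -- Then `√d * h = u / (10 * √d)`, and `8 * √d + 2 ≤ 10 * √d`.
  set h := u / (10 * d) with hh
  have hh0 : 0 < h := by positivity
  have hT : 6 * u / ε ≤ 7 * (1 + a) := by
    rw [div_le_iff₀ hε]
    nlinarith
  obtain ⟨N, hNc, hN⟩ := exists_finset_grid d ⌈7 * (1 + a) / h⌉₊ hh0
    (T := 7 * (1 + a)) (by rw [← div_le_iff₀ hh0]; exact Nat.le_ceil _)
  have hmesh : Real.sqrt d * h ≤ u / (2 * (4 * Real.sqrt d + 1)) := by
    rw [hh, ← mul_div_assoc, div_le_div_iff₀ (by positivity) (by positivity)]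
    have h1 := mul_nonneg hu0.le (mul_nonneg (Real.sqrt_nonneg d) (sub_nonneg.2 hsq1))
    have h2 : u * (10 * (d : ℝ)) = 10 * u * (Real.sqrt d * Real.sqrt d) := by rw [hsq]; ring
    rw [h2]
    linarith
  -- Corners of the grid's box are discarded, as their Gaussian factor would be too large. Points
  -- approximating the ball of radius `7 * (1 + a)` survive, since rounding moves them by at most
  -- one.
  refine ⟨⌈7 * (1 + a) / h⌉₊, N.filter fun t => ‖t‖ ≤ 8 * (1 + a), ?_, ?_, ?_, ?_⟩
  · refine (Nat.ceil_lt_add_one (by positivity)).le.trans ?_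
    refine add_le_add_left ?_ 1
    rw [hh, div_div_eq_mul_div, div_le_div_iff₀ hu0 hm0]
    have h1 : 70 * m ≤ 640 * u := by linarith
    have h2 : 0 ≤ (1 + a) * d := by positivity
    linarith [mul_le_mul_of_nonneg_left h1 h2]
  · exact (Finset.card_filter_le _ _).trans hNc
  · intro t ht
    exact (Finset.mem_filter.1 ht).2
  · intro t ht
    obtain ⟨s, hsN, hs⟩ := hN t (ht.trans hT)
    refine ⟨s, Finset.mem_filter.2 ⟨hsN, ?_⟩, hs.trans hmesh⟩
    have h1 : ‖s‖ ≤ ‖s - t‖ + ‖t‖ := by simpa using norm_add_le (s - t) t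
    have h2 : u / (2 * (4 * Real.sqrt d + 1)) ≤ 1 := by
      rw [div_le_one (by positivity)]; linarith
    linarith

/-! ### Assembly. -/

theorem mainTheorem4 :
    ∃ C : ℝ, 0 < C ∧
      ∀ (α ε : ℝ) (d n : ℕ), 0 < α → α < 1 / 4 → 0 < ε → ε < 1 → 1 ≤ d →
        C * ((d : ℝ) / max α ε ^ 2) * Real.log (2 * (d : ℝ) / max α ε)
            * Real.exp (C * (α / ε) ^ 2) ≤ (n : ℝ) →
        ∃ estimator : (Fin n → EuclideanSpace ℝ (Fin d)) → EuclideanSpace ℝ (Fin d),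
          Measurable estimator ∧
          ∀ (μ : EuclideanSpace ℝ (Fin d)) (Q : Measure (EuclideanSpace ℝ (Fin d))),
            IsProbabilityMeasure Q →
            (2 / 3 : ℝ) ≤
              (iidSamples
                (meanShiftContaminated (stdGaussian (EuclideanSpace ℝ (Fin d))) Q α μ) n).real
                {x | ‖estimator x - μ‖ ≤ ε} := by
  refine ⟨61440 * Real.exp 128, by positivity, ?_⟩
  intro α ε d n hα0 hα hε hε1 hd hn
  obtain ⟨m, hm⟩ : ∃ m, m = max α ε := ⟨_, rfl⟩
  rw [← hm] at hn
  have hm0 : 0 < m := by rw [hm]; exact lt_max_of_lt_left hα0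
  have hm1 : m < 1 := by rw [hm]; exact max_lt (by linarith) hε1
  have hαm : α ≤ m := by rw [hm]; exact le_max_left _ _
  have hd' : (1 : ℝ) ≤ d := by exact_mod_cast hd
  have hn0 : 0 < n := by
    have hlog : 0 < Real.log (2 * (d : ℝ) / m) :=
      Real.log_pos (by rw [lt_div_iff₀ hm0]; linarith)
    have : (0 : ℝ) < n := lt_of_lt_of_le (by positivity) hn
    exact_mod_cast this
  obtain ⟨k, N, hk, hNc, hNT, hNnet⟩ := exists_test_frequencies hα0 hα hε hm hm1 hd
  have hsize := sample_size_bound hα0 hε hm0 hm1 hd hn hk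
  obtain ⟨est, hest, hacc⟩ := exists_measurable_selection
    (fun (x : Fin n → EuclideanSpace ℝ (Fin d)) ν =>
      AcceptsMean N α (α + m / 8) (4 * Real.sqrt d + 1) x ν)
    (measurableSet_acceptsMean N α (α + m / 8) (4 * Real.sqrt d + 1) n)
  refine ⟨est, hest, ?_⟩
  intro μ Q hQ
  obtain ⟨P, hP⟩ : ∃ P, P = meanShiftContaminated (stdGaussian (EuclideanSpace ℝ (Fin d))) Q α μ :=
    ⟨_, rfl⟩
  have hPprob : IsProbabilityMeasure P := by
    rw [hP]
    exact isProbabilityMeasure_meanShiftContaminated _ _ hα0.le (by linarith) μ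
  have : IsProbabilityMeasure (iidSamples P n) := by unfold iidSamples; infer_instance
  rw [← hP]
  obtain ⟨s, hs⟩ : ∃ s, s = m / 32 * Real.exp (-((8 * (1 + α / ε)) ^ 2 / 2)) := ⟨_, rfl⟩
  rw [← hs] at hsize
  have hs0 : 0 ≤ s := by rw [hs]; positivity
  have hs1 : s ≤ 1 / 32 := by
    have : Real.exp (-((8 * (1 + α / ε)) ^ 2 / 2)) ≤ 1 :=
      Real.exp_le_one_iff.2 (neg_nonpos.2 (by positivity))
    rw [hs]
    nlinarith [Real.exp_pos (-((8 * (1 + α / ε)) ^ 2 / 2))]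
  have hbad := iidSamples_deviation_union P N (A := Metric.closedBall μ (4 * Real.sqrt d))
    Metric.isClosed_closedBall.measurableSet hn0 hs0
  have hsub : {x | ‖est x - μ‖ ≤ ε}ᶜ ⊆ {x : Fin n → EuclideanSpace ℝ (Fin d) |
      ¬ (|empiricalMass x (Metric.closedBall μ (4 * Real.sqrt d)) -
        P.real (Metric.closedBall μ (4 * Real.sqrt d))| < s ∧
      (∀ t ∈ N, |(empiricalCharFun x t).re - (charFun P t).re| < s) ∧
      ∀ t ∈ N, |(empiricalCharFun x t).im - (charFun P t).im| < s)} := by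
    intro x hx hgood
    apply hx
    have hμ := eventually_acceptsMean
      (acceptsMean_of_deviation hd hα0.le hα hs1 hs hm0 hNT μ Q P hP hgood.1 hgood.2.1 hgood.2.2)
    -- The estimate and `μ` both pass at radius `4 * √d + 1`; `u ≤ 3 / 8` because `α < 1 / 4` and `m
    -- < 1`.
    exact dist_le_of_acceptsMean hα hε (by positivity) (by linarith) (by positivity) le_rfl
      hNnet (hacc x μ hμ) hμ.self_of_nhds
  have hmeas : MeasurableSet {x | ‖est x - μ‖ ≤ ε} :=
    measurableSet_le (by fun_prop) measurable_const
  have hcompl := (measureReal_mono (μ := iidSamples P n) hsub).trans hbad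
  rw [probReal_compl_eq_one_sub hmeas] at hcompl
  -- The count `2 * (2 * N.card + 1)` is at most `6 * (2 * k + 1)^d`; failure probability `1 / 3`
  -- then explains the `18` in `sample_size_bound`.
  have hcount : (2 * (N.card : ℝ) + 1) * (2 * Real.exp (-(n * s ^ 2 / 2))) ≤ 1 / 3 := by
    have h1 : (N.card : ℝ) ≤ ((2 * k + 1 : ℕ) : ℝ) ^ d := by exact_mod_cast hNc
    have h2 : (1 : ℝ) ≤ ((2 * k + 1 : ℕ) : ℝ) ^ d :=
      one_le_pow₀ (by exact_mod_cast (by omega : 1 ≤ 2 * k + 1))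
    have := Real.exp_pos (-(n * s ^ 2 / 2))
    nlinarith
  linarith
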